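/- Let $F\in\{\mathbb R,\mathbb C,\mathbb H\}$ (real, complex, quaternion entries) and correspondingly $\beta=1,2,4$, and let $N\ge 1$. Let $\mathcal R_N^{(F)}$ be the space of $N\times N$ correlation matrices with entries in $F$, i.e. Hermitian positive definite matrices $R=[\rho_{jk}]$ with all diagonal entries equal to $1$. It is viewed as a subset of $\mathbb R^{\beta N(N-1)/2}$ through the $\beta$ real components of each of the entries $\rho_{jk}$, $j<k$, and $(\mathrm dR)$ denotes Lebesgue measure in these coordinates. For $F=\mathbb H$, matrices are represented by complex $2N\times 2N$ matrices, each entry $z+w\,\mathbf j$ ($z,w\in\mathbb C$) being replaced by the block $\begin{bmatrix} z&w\\-\overline w&\overline z\end{bmatrix}$; positive definiteness is that of the representing matrix, and $\det R$ denotes the positive square root of its determinant. For every real $a>-1$ the function $(\det R)^a$ is integrable on $\mathcal R_N^{(F)}$, and the normalisation $$C^{(F)}_{a,N}=\int_{\mathcal R_N^{(F)}}(\det R)^a\,(\mathrm dR)>0$$ of the probability density $(\det R)^a/C^{(F)}_{a,N}$ is given by \begin{align*} C^{(F)}_{a,N}&=\prod_{k=1}^{N-1}\prod_{s=0}^{\beta-1}B\Big(a+\frac{\beta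 k+1-s}{2},\frac12\Big)^{k} =\prod_{k=1}^{N-1}\left(\frac{\pi^{\beta/2}\,\Gamma\big(a+\frac{\beta(k-1)}2+1\big)}{\Gamma\big(a+\frac{\beta k}2+1\big)}\right)^{k}\\ &=\frac{\pi^{\beta N(N-1)/4}}{\Gamma\big(a+\frac\beta2(N-1)+1\big)^{N-1}}\prod_{k=1}^{N-1}\Gamma\Big(a+\frac\beta2(k-1)+1\Big), \end{align*} where $B(x,y)=\Gamma(x)\Gamma(y)/\Gamma(x+y)$. In particular, the Lebesgue measure (volume) of $\mathcal R_N^{(F)}$ is $C^{(F)}_{0,N}$, that is, it is given by these formulas at $a=0$. -/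

import Mathlib

open scoped Quaternion ComplexOrder

noncomputable section

/-- The three kinds of matrix entries: real, complex, quaternion. -/
inductive EntryField
  | real
  | complex
  | quaternion

/-- The number of independent real components of an entry (the index `β = 1, 2, 4`). -/
def EntryField.beta : EntryField → ℕ
  | .real => 1
  | .complex => 2
  | .quaternion => 4

/-- The positions strictly above the diagonal of an `N × N` matrix. -/
abbrev UpperPairs (N : ℕ) : Type := {p : Fin N × Fin N // p.1 < p.2}

/-- The real components of the strictly upper triangular entries: the space `ℝ^{β N (N-1) / 2}`
with its Lebesgue measure. -/
abbrev EntryCoords (F : EntryField) (N : ℕ) : Type := UpperPairs N → Fin F.beta → ℝ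

/-- The Hermitian matrix with unit diagonal and with prescribed strictly upper triangular
entries. -/
def unitDiagHermitian {A : Type*} [One A] [Star A] {N : ℕ} (u : UpperPairs N → A) :
    Matrix (Fin N) (Fin N) A :=
  Matrix.of fun j k =>
    if h : j < k then u ⟨(j, k), h⟩
    else if h : k < j then star (u ⟨(k, j), h⟩)
    else 1

/-- The real symmetric matrix with unit diagonal with given components. -/
def realMatrix {N : ℕ} (x : EntryCoords .real N) : Matrix (Fin N) (Fin N) ℝ :=
  unitDiagHermitian fun p => x p (0 : Fin 1)

/-- The complex Hermitian matrix with unit diagonal with given components. -/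
def complexMatrix {N : ℕ} (x : EntryCoords .complex N) : Matrix (Fin N) (Fin N) ℂ :=
  unitDiagHermitian fun p => ⟨x p (0 : Fin 2), x p (1 : Fin 2)⟩

/-- The quaternion Hermitian matrix with unit diagonal with given components. -/
def quaternionMatrix {N : ℕ} (x : EntryCoords .quaternion N) : Matrix (Fin N) (Fin N) ℍ[ℝ] :=
  unitDiagHermitian fun p =>
    ⟨x p (0 : Fin 4), x p (1 : Fin 4), x p (2 : Fin 4), x p (3 : Fin 4)⟩

/-- The `2 × 2` complex block `[[z, w], [-conj w, conj z]]` of the quaternion `z + w j`. -/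
def quaternionBlock (q : ℍ[ℝ]) : Matrix (Fin 2) (Fin 2) ℂ :=
  !![⟨q.re, q.imI⟩, ⟨q.imJ, q.imK⟩; -star ⟨q.imJ, q.imK⟩, star ⟨q.re, q.imI⟩]

/-- The complex `2N × 2N` matrix obtained by replacing each quaternion entry by its block. -/
def quaternionMatrixRep {N : ℕ} (R : Matrix (Fin N) (Fin N) ℍ[ℝ]) :
    Matrix (Fin N × Fin 2) (Fin N × Fin 2) ℂ :=
  Matrix.comp (Fin N) (Fin N) (Fin 2) (Fin 2) ℂ (R.map quaternionBlock)

/-- The space of `N × N` correlation matrices (positive definite with unit diagonal), described by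
the real components of the strictly upper triangular entries. -/
def correlationSet : (F : EntryField) → (N : ℕ) → Set (EntryCoords F N)
  | .real, _ => {x | (realMatrix x).PosDef}
  | .complex, _ => {x | (complexMatrix x).PosDef}
  | .quaternion, _ => {x | (quaternionMatrixRep (quaternionMatrix x)).PosDef}

/-- The determinant of the matrix with given components. In the quaternion case it is the square
root of the determinant of the complex representation. -/
def correlationDet : (F : EntryField) → (N : ℕ) → EntryCoords F N → ℝ
  | .real, _ => fun x => (realMatrix x).det
  | .complex, _ => fun x => (complexMatrix x).det.re
  | .quaternion, _ => fun x => √((quaternionMatrixRep (quaternionMatrix x)).det.re)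

/-- The normalisation of the density `(det R) ^ a` on the space of correlation matrices. -/
def correlationNormalisation (F : EntryField) (N : ℕ) (a : ℝ) : ℝ :=
  ∫ x in correlationSet F N, correlationDet F N x ^ a

end

open MeasureTheory Set
open scoped ENNReal ComplexOrder Matrix Quaternion

/-! ### The Euclidean ball integral. -/

section BallIntegral

/-! Border a correlation matrix R of size N by a column u, and write R = L Lᴴ, u = L w. The bordered
matrix is congruent to the identity of size N bordered by the single entry 1 - |w|², so it is
positive definite exactly when |w| < 1, and its determinant is det R · (1 - |w|²). The real-linear
map w ↦ L w on ℝ^(βN) has determinant (det L)^β = (det R)^(β/2). Fubini therefore expresses C(a,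
N+1) as C(a + β/2, N) times the integral of (1 - |w|²)^a over the unit ball (`detIntegral_succ`),
and that integral is π^(βN/2) Γ(a+1) / Γ(a + βN/2 + 1) (`lintegral_one_sub_sum_sq_rpow`). Induction
on the size for all a at once, with telescoping Gamma quotients, gives the product formulas.

`EntryModel` treats the three kinds of entries together. To avoid a determinant over the
quaternions, `IsFactor` carries a number δ > 0 in the role of det L and records two honest
determinants of L: in the block representation, which defines det R, and in the left regular
representation, which is the Jacobian. Both propagate because the Cholesky factor is block
triangular.

The integrals are evaluated in `ℝ≥0∞`, so integrability follows from the finite value. -/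

theorem lintegral_eq_abs_det_mul_lintegral_comp {E : Type*} [NormedAddCommGroup E]
    [NormedSpace ℝ E] [MeasurableSpace E] [BorelSpace E] [FiniteDimensional ℝ E]
    (μ : Measure E) [μ.IsAddHaarMeasure] {T : E →ₗ[ℝ] E} (hT : LinearMap.det T ≠ 0)
    {f : E → ℝ≥0∞} (hf : Measurable f) :
    ∫⁻ x, f x ∂μ = ENNReal.ofReal |LinearMap.det T| * ∫⁻ x, f (T x) ∂μ := by
  have hTm : Measurable T := (LinearMap.continuous_of_finiteDimensional T).measurable
  rw [← lintegral_map hf hTm, Measure.map_linearMap_addHaar_eq_smul_addHaar μ hT,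
    lintegral_smul_measure, smul_eq_mul, ← mul_assoc, ← ENNReal.ofReal_mul (abs_nonneg _),
    ← abs_mul, mul_inv_cancel₀ hT, abs_one, ENNReal.ofReal_one, one_mul]

theorem lintegral_Ioi_rpow_mul_exp_neg {a : ℝ} (ha : -1 < a) :
    ∫⁻ t in Ioi (0 : ℝ), ENNReal.ofReal (t ^ a * Real.exp (-t)) =
      ENNReal.ofReal (Real.Gamma (a + 1)) := by
  have h0 : 0 < a + 1 := by linarith
  rw [Real.Gamma_eq_integral h0, ofReal_integral_eq_lintegral_ofReal
    (Real.GammaIntegral_convergent h0)]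
  · simp [mul_comm]
  · filter_upwards [ae_restrict_mem measurableSet_Ioi] with t ht
    have : (0 : ℝ) < t := ht
    positivity

variable {ι κ : Type*} [Fintype ι] [Fintype κ]

theorem lintegral_exp_neg_sum_sq :
    ∫⁻ w : ι → κ → ℝ, ENNReal.ofReal (Real.exp (-∑ i, ∑ j, w i j ^ 2)) =
      ENNReal.ofReal (Real.pi ^ ((Fintype.card ι * Fintype.card κ : ℕ) / 2 : ℝ)) := by
  have key (w : ι → κ → ℝ) : Real.exp (-∑ i, ∑ j, w i j ^ 2) =
      ∏ i, ∏ j, Real.exp (-1 * w i j ^ 2) := by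
    rw [← Finset.sum_neg_distrib, Real.exp_sum]
    refine Finset.prod_congr rfl fun i _ => ?_
    rw [← Finset.sum_neg_distrib, Real.exp_sum]
    simp
  have hint : Integrable fun w : ι → κ → ℝ => Real.exp (-∑ i, ∑ j, w i j ^ 2) := by
    simp_rw [key]
    exact Integrable.fintype_prod (f := fun (_ : ι) (v : κ → ℝ) => ∏ j, Real.exp (-1 * v j ^ 2))
      fun _ => Integrable.fintype_prod (f := fun (_ : κ) (x : ℝ) => Real.exp (-1 * x ^ 2))
      fun _ => integrable_exp_neg_mul_sq one_pos
  rw [← ofReal_integral_eq_lintegral_ofReal hint (Filter.Eventually.of_forall fun _ => by positivity)]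
  simp_rw [key]
  rw [integral_fintype_prod_volume_eq_pow (fun v : κ → ℝ => ∏ j, Real.exp (-1 * v j ^ 2)),
    integral_fintype_prod_volume_eq_pow (fun x : ℝ => Real.exp (-1 * x ^ 2)), integral_gaussian,
    div_one, Real.sqrt_eq_rpow, ← Real.rpow_natCast, ← Real.rpow_natCast, ← Real.rpow_mul (by positivity),
    ← Real.rpow_mul (by positivity)]
  push_cast
  ring_nf

/-- The integral of `(1 - |w| ^ 2) ^ a` over the Euclidean unit ball. -/
theorem lintegral_one_sub_sum_sq_rpow {a : ℝ} (ha : -1 < a) :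
    ∫⁻ w : ι → κ → ℝ, {w : ι → κ → ℝ | ∑ i, ∑ j, w i j ^ 2 < 1}.indicator
        (fun w => ENNReal.ofReal ((1 - ∑ i, ∑ j, w i j ^ 2) ^ a)) w =
      ENNReal.ofReal (Real.pi ^ ((Fintype.card ι * Fintype.card κ : ℕ) / 2 : ℝ) *
        Real.Gamma (a + 1) /
        Real.Gamma (a + (Fintype.card ι * Fintype.card κ : ℕ) / 2 + 1)) := by
  set m : ℕ := Fintype.card ι * Fintype.card κ with hm
  set q : (ι → κ → ℝ) → ℝ := fun w => ∑ i, ∑ j, w i j ^ 2 with hq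
  have hqm : Measurable q := by fun_prop
  have hq0 (w) : 0 ≤ q w := by positivity
  set K := ∫⁻ w, {w | q w < 1}.indicator (fun w => ENNReal.ofReal ((1 - q w) ^ a)) w with hK
  -- The integral of G over t > 0 and all w is computed in two orders. For fixed t, the dilation w ↦
  -- √t w yields Γ(a + m/2 + 1) K; for fixed w, the translation t ↦ t + q w yields Γ(a + 1) times a
  -- Gaussian integral.
  let G : ℝ → (ι → κ → ℝ) → ℝ≥0∞ := fun t w =>
    {p : ℝ × (ι → κ → ℝ) | q p.2 < p.1}.indicator
      (fun p => ENNReal.ofReal ((p.1 - q p.2) ^ a * Real.exp (-p.1))) (t, w)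
  have hG : Measurable (Function.uncurry G) :=
    Measurable.indicator (by fun_prop) (measurableSet_lt (by fun_prop) (by fun_prop))
  have hKm : Measurable fun w => {w | q w < 1}.indicator
      (fun w => ENNReal.ofReal ((1 - q w) ^ a)) w :=
    Measurable.indicator (by fun_prop) (measurableSet_lt hqm measurable_const)
  have hm2 : -1 < a + m / 2 := by have : (0 : ℝ) ≤ m / 2 := by positivity
                                  linarith
  have h1 : ∫⁻ t in Ioi (0 : ℝ), ∫⁻ w, G t w = ENNReal.ofReal (Real.Gamma (a + m / 2 + 1)) * K := by
    rw [← lintegral_Ioi_rpow_mul_exp_neg hm2, ← lintegral_mul_const _ (by fun_prop)]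
    refine setLIntegral_congr_fun measurableSet_Ioi fun t (ht : 0 < t) => ?_
    obtain ⟨T, hT⟩ : ∃ T : (ι → κ → ℝ) →ₗ[ℝ] (ι → κ → ℝ), T = √t • LinearMap.id := ⟨_, rfl⟩
    have hdet : LinearMap.det T = t ^ ((m : ℝ) / 2) := by
      rw [hT, LinearMap.det_smul, LinearMap.det_id, mul_one, Real.sqrt_eq_rpow,
        ← Real.rpow_natCast, ← Real.rpow_mul ht.le]
      simp [Module.finrank_pi_fintype, hm]
      ring_nf
    have hpos : 0 < t ^ ((m : ℝ) / 2) := by positivity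
    have hGT (w) : G t (T w) = ENNReal.ofReal (t ^ a * Real.exp (-t)) *
        {w | q w < 1}.indicator (fun w => ENNReal.ofReal ((1 - q w) ^ a)) w := by
      have hqs : q (T w) = t * q w := by
        simp [hq, hT, mul_pow, Real.sq_sqrt ht.le, Finset.mul_sum]
      simp only [G, indicator, mem_ofPred_eq, hqs]
      have hiff : t * q w < t ↔ q w < 1 := by
        conv_lhs => rw [← mul_one t, mul_assoc, one_mul]
        exact mul_lt_mul_iff_right₀ ht
      by_cases h : q w < 1
      · rw [if_pos (hiff.2 h), if_pos h, ← ENNReal.ofReal_mul (by positivity),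
          show t - t * q w = t * (1 - q w) by ring, Real.mul_rpow ht.le (by linarith)]
        ring_nf
      · rw [if_neg (mt hiff.1 h), if_neg h, mul_zero]
    have hGt : Measurable (G t) := hG.of_uncurry_left
    have hdet0 : LinearMap.det T ≠ 0 := by rw [hdet]; exact hpos.ne'
    have hcv : ∫⁻ w, G t w = ENNReal.ofReal |LinearMap.det T| * ∫⁻ w, G t (T w) :=
      lintegral_eq_abs_det_mul_lintegral_comp volume hdet0 hGt
    simp only [hcv, hGT]
    rw [lintegral_const_mul _ hKm, ← hK, hdet, abs_of_pos hpos, ← mul_assoc,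
      ← ENNReal.ofReal_mul hpos.le, Real.rpow_add ht]
    ring_nf
  have h2 : ∫⁻ t in Ioi (0 : ℝ), ∫⁻ w, G t w =
      ENNReal.ofReal (Real.Gamma (a + 1)) * ENNReal.ofReal (Real.pi ^ ((m : ℝ) / 2)) := by
    rw [lintegral_lintegral_swap hG.aemeasurable, ← lintegral_exp_neg_sum_sq,
      ← lintegral_const_mul _ (by fun_prop)]
    refine lintegral_congr fun w => ?_
    -- After translating t by q w, the condition q w < t becomes 0 < t, and this implies the
    -- constraint of the outer domain because q w ≥ 0.
    rw [← lintegral_indicator measurableSet_Ioi,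
      ← lintegral_add_right_eq_self _ (q w), ← lintegral_Ioi_rpow_mul_exp_neg ha,
      ← lintegral_indicator measurableSet_Ioi, ← lintegral_mul_const]
    · refine lintegral_congr fun t => ?_
      simp only [G, indicator, mem_ofPred_eq, mem_Ioi]
      by_cases h : 0 < t
      · rw [if_pos (by linarith [hq0 w]), if_pos (by linarith), if_pos h,
          ← ENNReal.ofReal_mul (by positivity), add_sub_cancel_right, neg_add, Real.exp_add, mul_assoc]
      · rw [if_neg (c := q w < _) (by linarith), if_neg h, zero_mul, ite_self]
    · exact Measurable.indicator (by fun_prop) measurableSet_Ioi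
  have hg : 0 < Real.Gamma (a + m / 2 + 1) := Real.Gamma_pos_of_pos (by linarith)
  rw [h1, ← ENNReal.ofReal_mul (Real.Gamma_pos_of_pos (by linarith)).le] at h2
  rw [mul_comm (Real.pi ^ _), ENNReal.ofReal_div_of_pos hg, ← h2]
  exact (ENNReal.eq_div_iff (by simpa using hg) ENNReal.ofReal_ne_top).2 rfl

end BallIntegral

/-! ### Entry algebras and their block representations. -/

/-- A real division algebra of matrix entries with chosen orthonormal coordinates, together with
a representation by matrices over `ℝ` or `ℂ`. -/
structure EntryModel (A : Type*) [Ring A] [StarRing A] [Algebra ℝ A] [StarModule ℝ A]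
    (b : ℕ) (m : Type*) [Fintype m] [DecidableEq m] (𝕜 : Type*) [RCLike 𝕜] where
  /-- The real components of an entry. -/
  coord : (Fin b → ℝ) ≃ₗ[ℝ] A
  star_mul_self : ∀ x, star (coord x) * coord x = algebraMap ℝ A (∑ i, x i ^ 2)
  /-- The block replacing an entry. -/
  rep : A →⋆ₐ[ℝ] Matrix m m 𝕜

theorem isUnit_fromBlocks_zero₁₂_of_isUnit {A : Type*} [Ring A] {n n' : Type*} [Fintype n]
    [DecidableEq n] [Fintype n'] [DecidableEq n'] {L : Matrix n n A} (hL : IsUnit L)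
    (C : Matrix n' n A) {D : Matrix n' n' A} (hD : IsUnit D) :
    IsUnit (Matrix.fromBlocks L 0 C D) := by
  obtain ⟨⟨L, L', h1, h2⟩, rfl⟩ := hL
  obtain ⟨⟨D, D', h3, h4⟩, rfl⟩ := hD
  refine ⟨⟨Matrix.fromBlocks L 0 C D, Matrix.fromBlocks L' 0 (-(D' * C * L')) D', ?_, ?_⟩, rfl⟩
  · simp [Matrix.fromBlocks_multiply, h1, h3, ← Matrix.mul_assoc]
  · simp [Matrix.fromBlocks_multiply, h2, h4, Matrix.mul_assoc]

noncomputable section BlockRep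

variable {A : Type*} [Ring A] [Algebra ℝ A] {K : Type*} [Field K] [Algebra ℝ K]
  {m n n' : Type*} [Fintype m] [DecidableEq m] [Fintype n] [DecidableEq n] [Fintype n'] [DecidableEq n']

/-- The extension of a matrix representation of `A` to matrices with entries in `A`. -/
def blockRep (σ : A →ₐ[ℝ] Matrix m m K) (n : Type*) [Fintype n] [DecidableEq n] :
    Matrix n n A →ₐ[ℝ] Matrix (n × m) (n × m) K :=
  AlgHom.comp (Matrix.compAlgEquiv n m K ℝ).toAlgHom σ.mapMatrix

theorem blockRep_apply (σ : A →ₐ[ℝ] Matrix m m K) (M : Matrix n n A) (p q : n × m) :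
    blockRep σ n M p q = σ (M p.1 q.1) p.2 q.2 := rfl

theorem blockRep_submatrix (σ : A →ₐ[ℝ] Matrix m m K) (M : Matrix n n A) (e : n' ≃ n) :
    blockRep σ n' (M.submatrix e e) =
      (blockRep σ n M).submatrix (e.prodCongr (Equiv.refl m)) (e.prodCongr (Equiv.refl m)) := rfl

theorem det_blockRep_submatrix (σ : A →ₐ[ℝ] Matrix m m K) (M : Matrix n n A) (e : n' ≃ n) :
    (blockRep σ n' (M.submatrix e e)).det = (blockRep σ n M).det := by
  rw [blockRep_submatrix, Matrix.det_submatrix_equiv_self]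

theorem det_blockRep_algebraMap (σ : A →ₐ[ℝ] Matrix m m K) (c : ℝ) :
    (blockRep σ n (algebraMap ℝ (Matrix n n A) c)).det =
      algebraMap ℝ K c ^ (Fintype.card n * Fintype.card m) := by
  rw [AlgHom.commutes, Matrix.algebraMap_eq_diagonal, Matrix.det_diagonal]
  simp

/-- Only the commutative side has a determinant: regrouping the indices as a disjoint union makes
the represented matrix block triangular over K. -/
theorem det_blockRep_fromBlocks_zero₁₂ (σ : A →ₐ[ℝ] Matrix m m K) (L : Matrix n n A)
    (C : Matrix n' n A) (D : Matrix n' n' A) :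
    (blockRep σ (n ⊕ n') (Matrix.fromBlocks L 0 C D)).det =
      (blockRep σ n L).det * (blockRep σ n' D).det := by
  rw [← Matrix.det_submatrix_equiv_self (Equiv.sumProdDistrib n n' m).symm,
    ← Matrix.det_fromBlocks_zero₁₂ _ (Matrix.of fun p q => σ (C p.1 q.1) p.2 q.2)]
  congr 1
  ext (p | p) (q | q) <;> simp [blockRep_apply]

theorem blockRep_conjTranspose {𝕜 : Type*} [RCLike 𝕜] [StarRing A] (σ : A →⋆ₐ[ℝ] Matrix m m 𝕜)
    (M : Matrix n n A) :
    blockRep σ.toAlgHom n Mᴴ = (blockRep σ.toAlgHom n M)ᴴ := by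
  ext p q
  have h : σ (star (M q.1 p.1)) = star (σ (M q.1 p.1)) := map_star σ _
  simpa [blockRep_apply] using congrFun (congrFun h p.2) q.2

theorem posDef_blockRep_submatrix {𝕜 : Type*} [RCLike 𝕜] (σ : A →ₐ[ℝ] Matrix m m 𝕜)
    (M : Matrix n n A) (e : n' ≃ n) :
    (blockRep σ n' (M.submatrix e e)).PosDef ↔ (blockRep σ n M).PosDef := by
  rw [blockRep_submatrix]
  refine ⟨fun h => ?_, fun h => h.submatrix (Equiv.injective _)⟩
  have := h.submatrix (e.prodCongr (Equiv.refl m)).symm.injective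
  rwa [Matrix.submatrix_submatrix, Equiv.self_comp_symm, Matrix.submatrix_id_id] at this

end BlockRep

/-! ### Factorisations M = L Lᴴ and their extension to bordered matrices. -/

namespace EntryModel

noncomputable section

variable {A : Type*} [Ring A] [StarRing A] [Algebra ℝ A] [StarModule ℝ A]
  {b : ℕ} {m : Type*} [Fintype m] [DecidableEq m] {𝕜 : Type*} [RCLike 𝕜]
  {n n' : Type*} [Fintype n] [DecidableEq n] [Fintype n'] [DecidableEq n']
  (E : EntryModel A b m 𝕜)

/-- The left regular representation of the entries in the chosen coordinates. -/
def leftRep : A →ₐ[ℝ] Matrix (Fin b) (Fin b) ℝ :=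
  Algebra.leftMulMatrix (Module.Basis.ofEquivFun E.coord.symm)

/-- Left multiplication of vectors by a matrix, in real coordinates. -/
def mulLeft (L : Matrix n n A) : (n → Fin b → ℝ) →ₗ[ℝ] (n → Fin b → ℝ) :=
  (LinearEquiv.curry ℝ ℝ n (Fin b)).toLinearMap ∘ₗ
    Matrix.toLin' (blockRep E.leftRep n L) ∘ₗ (LinearEquiv.curry ℝ ℝ n (Fin b)).symm.toLinearMap

theorem det_mulLeft (L : Matrix n n A) :
    LinearMap.det (E.mulLeft L) = (blockRep E.leftRep n L).det := by
  rw [mulLeft, LinearMap.det_conj, LinearMap.det_toLin']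

/-- The column of entries with given components. -/
def col (w : n → Fin b → ℝ) : Matrix n (Fin 1) A := Matrix.of fun i _ => E.coord (w i)

theorem coord_leftRep_mulVec (x : A) (v : Fin b → ℝ) :
    E.coord (E.leftRep x *ᵥ v) = x * E.coord v := by
  have h := Algebra.leftMulMatrix_mulVec_repr (Module.Basis.ofEquivFun E.coord.symm) x (E.coord v)
  have h2 (y : A) : ⇑((Module.Basis.ofEquivFun E.coord.symm).repr y) = E.coord.symm y := by
    ext; simp
  rw [h2, h2, LinearEquiv.symm_apply_apply] at h
  rw [leftRep, h, LinearEquiv.apply_symm_apply]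

theorem col_mulLeft (L : Matrix n n A) (w : n → Fin b → ℝ) :
    E.col (E.mulLeft L w) = L * E.col w := by
  ext i k
  have h : E.mulLeft L w i = ∑ j, E.leftRep (L i j) *ᵥ w j := by
    ext a
    simp [mulLeft, Matrix.mulVec, dotProduct, blockRep_apply, Fintype.sum_prod_type]
  simp [col, h, Matrix.mul_apply, coord_leftRep_mulVec]

theorem col_conjTranspose_mul_col {n : Type*} [Fintype n] (w : n → Fin b → ℝ) :
    (E.col w)ᴴ * E.col w = algebraMap ℝ (Matrix (Fin 1) (Fin 1) A) (∑ i, ∑ j, w i j ^ 2) := by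
  ext i j
  have h01 : i = j := Subsingleton.elim _ _
  simp only [Matrix.mul_apply, Matrix.conjTranspose_apply, col, Matrix.of_apply, E.star_mul_self,
    ← map_sum]
  simp [Matrix.algebraMap_matrix_apply, h01]

/-- A factorisation `M = L Lᴴ` where `δ` is the determinant of `L` over the algebra of entries. -/
structure IsFactor (M L : Matrix n n A) (δ : ℝ) : Prop where
  pos : 0 < δ
  isUnit : IsUnit L
  eq : M = L * Lᴴ
  det_rep : (blockRep E.rep.toAlgHom n L).det = (δ : 𝕜) ^ Fintype.card m
  det_leftRep : (blockRep E.leftRep n L).det = δ ^ b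

variable {E}

theorem IsFactor.submatrix {M L : Matrix n n A} {δ : ℝ} (h : E.IsFactor M L δ) (e : n' ≃ n) :
    E.IsFactor (M.submatrix e e) (L.submatrix e e) δ where
  pos := h.pos
  isUnit := by
    have := h.isUnit.map (Matrix.reindexRingEquiv A e.symm)
    simpa using this
  eq := by rw [h.eq, Matrix.conjTranspose_submatrix, Matrix.submatrix_mul_equiv]
  det_rep := by rw [det_blockRep_submatrix, h.det_rep]
  det_leftRep := by rw [det_blockRep_submatrix, h.det_leftRep]

theorem IsFactor.det_eq {M L : Matrix n n A} {δ : ℝ} (h : E.IsFactor M L δ) :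
    (blockRep E.rep.toAlgHom n M).det = ((δ ^ 2 : ℝ) : 𝕜) ^ Fintype.card m := by
  rw [h.eq, map_mul, blockRep_conjTranspose, Matrix.det_mul, Matrix.det_conjTranspose, h.det_rep]
  simp [← mul_pow, sq]

theorem IsFactor.posDef {M L : Matrix n n A} {δ : ℝ} (h : E.IsFactor M L δ) :
    (blockRep E.rep.toAlgHom n M).PosDef := by
  rw [h.eq, map_mul, blockRep_conjTranspose]
  refine Matrix.PosDef.mul_conjTranspose_self _ ?_
  exact Matrix.vecMul_injective_of_isUnit (h.isUnit.map (blockRep E.rep.toAlgHom n))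

/-- This is one Cholesky step: the new row of the factor is (wᴴ, √(1 - |w|²)), the last entry being
forced by the unit diagonal. -/
theorem IsFactor.fromBlocks {M L : Matrix n n A} {δ : ℝ} (h : E.IsFactor M L δ)
    {w : n → Fin b → ℝ} (hw : ∑ i, ∑ j, w i j ^ 2 < 1) :
    E.IsFactor (Matrix.fromBlocks M (E.col (E.mulLeft L w)) (E.col (E.mulLeft L w))ᴴ 1)
      (Matrix.fromBlocks L 0 (E.col w)ᴴ
        (algebraMap ℝ (Matrix (Fin 1) (Fin 1) A) √(1 - ∑ i, ∑ j, w i j ^ 2)))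
      (δ * √(1 - ∑ i, ∑ j, w i j ^ 2)) where
  pos := mul_pos h.pos (Real.sqrt_pos.2 (by linarith))
  isUnit := isUnit_fromBlocks_zero₁₂_of_isUnit h.isUnit _
    ((Real.sqrt_pos.2 (sub_pos.2 hw)).ne'.isUnit.map (algebraMap ℝ _))
  eq := by
    have hs : star √(1 - ∑ i, ∑ j, w i j ^ 2) = √(1 - ∑ i, ∑ j, w i j ^ 2) := rfl
    have h1 : (algebraMap ℝ (Matrix (Fin 1) (Fin 1) A) √(1 - ∑ i, ∑ j, w i j ^ 2))ᴴ =
        algebraMap ℝ (Matrix (Fin 1) (Fin 1) A) √(1 - ∑ i, ∑ j, w i j ^ 2) := by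
      rw [← Matrix.star_eq_conjTranspose, ← algebraMap_star_comm, hs]
    rw [Matrix.fromBlocks_conjTranspose, Matrix.fromBlocks_multiply, h1, ← map_mul,
      Real.mul_self_sqrt (by linarith)]
    simp [col_mulLeft, h.eq, col_conjTranspose_mul_col]
  det_rep := by
    rw [det_blockRep_fromBlocks_zero₁₂, h.det_rep, det_blockRep_algebraMap]
    simp [mul_pow]
  det_leftRep := by
    rw [det_blockRep_fromBlocks_zero₁₂, h.det_leftRep, det_blockRep_algebraMap]
    simp [mul_pow]

/-- For arbitrary w the Cholesky step may have no real square root, so the factor X keeps 1 in its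
corner and s = 1 - |w|² goes into a diagonal middle factor. X is invertible, so congruence preserves
positive definiteness and only the sign of s matters. `Nonempty m` makes s actually occur on the
represented diagonal. -/
theorem IsFactor.posDef_fromBlocks_iff [Nonempty m] {M L : Matrix n n A} {δ : ℝ}
    (h : E.IsFactor M L δ) (w : n → Fin b → ℝ) :
    (blockRep E.rep.toAlgHom (n ⊕ Fin 1)
      (Matrix.fromBlocks M (E.col (E.mulLeft L w)) (E.col (E.mulLeft L w))ᴴ 1)).PosDef ↔
      ∑ i, ∑ j, w i j ^ 2 < 1 := by
  set s := 1 - ∑ i, ∑ j, w i j ^ 2 with hs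
  set X := Matrix.fromBlocks L 0 (E.col w)ᴴ (1 : Matrix (Fin 1) (Fin 1) A) with hX
  have hXu : IsUnit X := isUnit_fromBlocks_zero₁₂_of_isUnit h.isUnit _ isUnit_one
  have heq : Matrix.fromBlocks M (E.col (E.mulLeft L w)) (E.col (E.mulLeft L w))ᴴ 1 =
      X * Matrix.fromBlocks 1 0 0 (algebraMap ℝ (Matrix (Fin 1) (Fin 1) A) s) * Xᴴ := by
    rw [hX, Matrix.fromBlocks_conjTranspose, Matrix.fromBlocks_multiply,
      Matrix.fromBlocks_multiply]
    simp [col_mulLeft, h.eq, col_conjTranspose_mul_col, hs]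
  have hD : blockRep E.rep.toAlgHom (n ⊕ Fin 1)
      (Matrix.fromBlocks 1 0 0 (algebraMap ℝ (Matrix (Fin 1) (Fin 1) A) s)) =
      Matrix.diagonal fun p => ((Sum.elim (fun _ => 1) (fun _ => s) p.1 : ℝ) : 𝕜) := by
    ext ⟨p, i⟩ ⟨q, j⟩
    rcases p with p | p <;> rcases q with q | q
    · by_cases hpq : p = q <;> simp [blockRep_apply, Matrix.diagonal_apply, Matrix.one_apply, hpq]
    · simp [blockRep_apply]
    · simp [blockRep_apply]
    · have hpq : p = q := Subsingleton.elim _ _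
      subst hpq
      simp [blockRep_apply, Matrix.diagonal_apply, Matrix.algebraMap_matrix_apply]
  rw [heq, map_mul, map_mul, blockRep_conjTranspose, ← Matrix.star_eq_conjTranspose,
    Matrix.IsUnit.posDef_star_right_conjugate_iff (hXu.map _), hD, Matrix.posDef_diagonal_iff]
  simp only [RCLike.ofReal_pos]
  constructor
  · intro h1
    exact sub_pos.1 (h1 (Sum.inr 0, Classical.arbitrary m))
  · rintro h1 ⟨p | p, i⟩
    · exact one_pos
    · exact sub_pos.2 h1

end

end EntryModel

/-! ### Splitting the coordinates of a bordered matrix. -/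

/-- The strictly upper triangular positions of a bordered matrix. -/
noncomputable def upperPairsSucc (N : ℕ) : UpperPairs N ⊕ Fin N ≃ UpperPairs (N + 1) :=
  Equiv.ofBijective
    (Sum.elim (fun p => ⟨(p.1.1.castSucc, p.1.2.castSucc), by simpa using p.2⟩)
      fun i => ⟨(i.castSucc, Fin.last N), Fin.castSucc_lt_last i⟩) <| by
    constructor
    · rintro (⟨⟨i, j⟩, h⟩ | i) (⟨⟨k, l⟩, h'⟩ | k) <;>
        simp [Fin.castSucc_ne_last, (Fin.castSucc_ne_last _).symm]
    · rintro ⟨⟨i, j⟩, h⟩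
      have hi : i ≠ Fin.last N := (h.trans_le (Fin.le_last _)).ne
      obtain ⟨i, rfl⟩ := Fin.exists_castSucc_eq.2 hi
      induction j using Fin.lastCases with
      | last => exact ⟨Sum.inr i, rfl⟩
      | cast j => exact ⟨Sum.inl ⟨(i, j), by simpa using h⟩, rfl⟩

/-- The components of a bordered matrix, from those of the matrix and of the new column. -/
noncomputable def borderEquiv (b N : ℕ) : (UpperPairs N → Fin b → ℝ) × (Fin N → Fin b → ℝ) ≃ᵐ
    (UpperPairs (N + 1) → Fin b → ℝ) :=
  (MeasurableEquiv.sumPiEquivProdPi fun _ => Fin b → ℝ).symm.trans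
    (MeasurableEquiv.piCongrLeft (fun _ => Fin b → ℝ) (upperPairsSucc N))

theorem measurePreserving_borderEquiv (b N : ℕ) : MeasurePreserving (borderEquiv b N) :=
  (volume_measurePreserving_sumPiEquivProdPi_symm fun _ => Fin b → ℝ).trans
    (volume_measurePreserving_piCongrLeft (fun _ => Fin b → ℝ) (upperPairsSucc N))

theorem borderEquiv_inl (b N : ℕ) (y : UpperPairs N → Fin b → ℝ) (u : Fin N → Fin b → ℝ)
    (p : UpperPairs N) : borderEquiv b N (y, u) (upperPairsSucc N (Sum.inl p)) = y p :=
  Equiv.piCongrLeft_apply_apply (fun _ => Fin b → ℝ) _ _ _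

theorem borderEquiv_inr (b N : ℕ) (y : UpperPairs N → Fin b → ℝ) (u : Fin N → Fin b → ℝ)
    (i : Fin N) : borderEquiv b N (y, u) (upperPairsSucc N (Sum.inr i)) = u i :=
  Equiv.piCongrLeft_apply_apply (fun _ => Fin b → ℝ) _ _ _

/-! ### The recursion in the matrix size. -/

namespace EntryModel

noncomputable section

variable {A : Type*} [Ring A] [StarRing A] [Algebra ℝ A] [StarModule ℝ A]
  {b : ℕ} {m : Type*} [Fintype m] [DecidableEq m] {𝕜 : Type*} [RCLike 𝕜]
  (E : EntryModel A b m 𝕜)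

/-- The Hermitian matrix with unit diagonal with given components. -/
def mat {N : ℕ} (x : UpperPairs N → Fin b → ℝ) : Matrix (Fin N) (Fin N) A :=
  unitDiagHermitian fun p => E.coord (x p)

/-- The matrix over `ℝ` or `ℂ` representing the matrix with given components. -/
def repMat {N : ℕ} (x : UpperPairs N → Fin b → ℝ) : Matrix (Fin N × m) (Fin N × m) 𝕜 :=
  blockRep E.rep.toAlgHom (Fin N) (E.mat x)

/-- The components of the positive definite matrices. -/
def posSet (N : ℕ) : Set (UpperPairs N → Fin b → ℝ) := {x | (E.repMat x).PosDef}

/-- The determinant over the algebra of entries. -/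
def detFn {N : ℕ} (x : UpperPairs N → Fin b → ℝ) : ℝ :=
  RCLike.re (E.repMat x).det ^ ((Fintype.card m : ℝ)⁻¹)

theorem mat_of_lt {N : ℕ} (x : UpperPairs N → Fin b → ℝ) {j k : Fin N} (h : j < k) :
    E.mat x j k = E.coord (x ⟨(j, k), h⟩) := dif_pos h

theorem mat_of_gt {N : ℕ} (x : UpperPairs N → Fin b → ℝ) {j k : Fin N} (h : k < j) :
    E.mat x j k = star (E.coord (x ⟨(k, j), h⟩)) := by
  simp [mat, unitDiagHermitian, h, h.not_gt]

theorem mat_borderEquiv {N : ℕ} (y : UpperPairs N → Fin b → ℝ) (u : Fin N → Fin b → ℝ) :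
    (E.mat (borderEquiv b N (y, u))).submatrix finSumFinEquiv finSumFinEquiv =
      Matrix.fromBlocks (E.mat y) (E.col u) (E.col u)ᴴ 1 := by
  ext (i | i) (j | j)
  · change E.mat (borderEquiv b N (y, u)) i.castSucc j.castSucc = E.mat y i j
    rcases lt_trichotomy i j with hij | hij | hij
    · exact (E.mat_of_lt _ (Fin.castSucc_lt_castSucc_iff.2 hij)).trans
        ((congrArg E.coord (borderEquiv_inl b N y u ⟨(i, j), hij⟩)).trans
          (E.mat_of_lt _ hij).symm)
    · simp [mat, unitDiagHermitian, hij]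
    · exact (E.mat_of_gt _ (Fin.castSucc_lt_castSucc_iff.2 hij)).trans
        ((congrArg (fun v => star (E.coord v)) (borderEquiv_inl b N y u ⟨(j, i), hij⟩)).trans
          (E.mat_of_gt _ hij).symm)
  · obtain rfl : j = 0 := Subsingleton.elim _ _
    exact (E.mat_of_lt _ (Fin.castSucc_lt_last i)).trans
      (congrArg E.coord (borderEquiv_inr b N y u i))
  · obtain rfl : i = 0 := Subsingleton.elim _ _
    exact (E.mat_of_gt _ (Fin.castSucc_lt_last j)).trans
      (congrArg (fun v => star (E.coord v)) (borderEquiv_inr b N y u j))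
  · obtain rfl : i = j := Subsingleton.elim _ _
    simp [mat, unitDiagHermitian]

theorem borderEquiv_mem_posSet_iff {N : ℕ} (y : UpperPairs N → Fin b → ℝ) (u : Fin N → Fin b → ℝ) :
    borderEquiv b N (y, u) ∈ E.posSet (N + 1) ↔ (blockRep E.rep.toAlgHom (Fin N ⊕ Fin 1)
      (Matrix.fromBlocks (E.mat y) (E.col u) (E.col u)ᴴ 1)).PosDef := by
  rw [← mat_borderEquiv, posDef_blockRep_submatrix]
  rfl

theorem mem_posSet_of_borderEquiv {N : ℕ} {y : UpperPairs N → Fin b → ℝ} {u : Fin N → Fin b → ℝ}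
    (h : borderEquiv b N (y, u) ∈ E.posSet (N + 1)) : y ∈ E.posSet N := by
  rw [borderEquiv_mem_posSet_iff] at h
  exact h.submatrix (e := Prod.map Sum.inl id) (Sum.inl_injective.prodMap Function.injective_id)

variable {E}

theorem IsFactor.det_mulLeft_eq {N : ℕ} {M L : Matrix (Fin N) (Fin N) A} {δ : ℝ}
    (h : E.IsFactor M L δ) : LinearMap.det (E.mulLeft L) = δ ^ b := by
  rw [det_mulLeft, h.det_leftRep]

theorem IsFactor.mulLeft_surjective {N : ℕ} {M L : Matrix (Fin N) (Fin N) A} {δ : ℝ}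
    (h : E.IsFactor M L δ) : Function.Surjective (E.mulLeft L) := by
  have hu : IsUnit (E.mulLeft L) := by
    rw [LinearMap.isUnit_iff_isUnit_det, h.det_mulLeft_eq]
    exact (pow_pos h.pos b).ne'.isUnit
  exact ((Module.End.isUnit_iff _).1 hu).2

theorem IsFactor.borderEquiv_mem_posSet_iff [Nonempty m] {N : ℕ} {y : UpperPairs N → Fin b → ℝ}
    {L : Matrix (Fin N) (Fin N) A} {δ : ℝ} (h : E.IsFactor (E.mat y) L δ) (w : Fin N → Fin b → ℝ) :
    borderEquiv b N (y, E.mulLeft L w) ∈ E.posSet (N + 1) ↔ ∑ i, ∑ j, w i j ^ 2 < 1 := by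
  rw [EntryModel.borderEquiv_mem_posSet_iff, h.posDef_fromBlocks_iff]

theorem IsFactor.borderEquiv {N : ℕ} {y : UpperPairs N → Fin b → ℝ}
    {L : Matrix (Fin N) (Fin N) A} {δ : ℝ} (h : E.IsFactor (E.mat y) L δ)
    {w : Fin N → Fin b → ℝ} (hw : ∑ i, ∑ j, w i j ^ 2 < 1) :
    ∃ L', E.IsFactor (E.mat (borderEquiv b N (y, E.mulLeft L w))) L'
      (δ * √(1 - ∑ i, ∑ j, w i j ^ 2)) := by
  have h1 := (h.fromBlocks hw).submatrix finSumFinEquiv.symm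
  rw [← mat_borderEquiv, Matrix.submatrix_submatrix, Equiv.self_comp_symm,
    Matrix.submatrix_id_id] at h1
  exact ⟨_, h1⟩

theorem IsFactor.detFn_eq [Nonempty m] {N : ℕ} {x : UpperPairs N → Fin b → ℝ}
    {L : Matrix (Fin N) (Fin N) A} {δ : ℝ} (h : E.IsFactor (E.mat x) L δ) :
    E.detFn x = δ ^ 2 := by
  rw [detFn, repMat, h.det_eq, ← RCLike.ofReal_pow, RCLike.ofReal_re,
    Real.pow_rpow_inv_natCast (sq_nonneg _) Fintype.card_ne_zero]

variable (E)

theorem isFactor_of_isEmpty (M : Matrix (Fin 0) (Fin 0) A) : E.IsFactor M 1 1 where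
  pos := one_pos
  isUnit := isUnit_one
  eq := Subsingleton.elim _ _
  det_rep := by simp
  det_leftRep := by simp

/-- The leading principal block is positive definite and has a factor L by induction. Since left
multiplication by L is onto, the last column is L w, and positive definiteness forces |w| < 1. -/
theorem exists_isFactor [Nonempty m] {N : ℕ} {x : UpperPairs N → Fin b → ℝ}
    (hx : x ∈ E.posSet N) : ∃ L δ, E.IsFactor (E.mat x) L δ := by
  induction N with
  | zero => exact ⟨1, 1, E.isFactor_of_isEmpty _⟩
  | succ N ih =>
    obtain ⟨⟨y, u⟩, rfl⟩ := (borderEquiv b N).surjective x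
    obtain ⟨L, δ, h⟩ := ih (E.mem_posSet_of_borderEquiv hx)
    obtain ⟨w, rfl⟩ := h.mulLeft_surjective u
    obtain ⟨L', h'⟩ := h.borderEquiv ((h.borderEquiv_mem_posSet_iff w).1 hx)
    exact ⟨L', _, h'⟩

theorem detFn_pos [Nonempty m] {N : ℕ} {x : UpperPairs N → Fin b → ℝ} (hx : x ∈ E.posSet N) :
    0 < E.detFn x := by
  obtain ⟨L, δ, h⟩ := E.exists_isFactor hx
  rw [h.detFn_eq]
  exact pow_pos h.pos 2

theorem continuous_repMat (N : ℕ) :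
    Continuous (E.repMat : (UpperPairs N → Fin b → ℝ) → _) := by
  refine continuous_matrix fun ⟨i, k⟩ ⟨j, l⟩ => ?_
  have h (p : UpperPairs N) (k l : m) :
      Continuous fun x : UpperPairs N → Fin b → ℝ => E.rep (E.coord (x p)) k l := by
    let f : (Fin b → ℝ) →ₗ[ℝ] 𝕜 := Matrix.entryLinearMap ℝ 𝕜 k l ∘ₗ
      E.rep.toAlgHom.toLinearMap ∘ₗ E.coord.toLinearMap
    exact (LinearMap.continuous_of_finiteDimensional f).comp (continuous_apply p)
  have hr (x : UpperPairs N → Fin b → ℝ) : E.repMat x (i, k) (j, l) = E.rep (E.mat x i j) k l := rfl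
  simp only [hr, mat, unitDiagHermitian, Matrix.of_apply]
  split_ifs
  · exact h _ _ _
  · simp only [map_star, Matrix.star_apply]
    exact (h _ _ _).star
  · exact continuous_const

theorem measurable_detFn (N : ℕ) : Measurable (E.detFn : (UpperPairs N → Fin b → ℝ) → ℝ) :=
  (RCLike.continuous_re.comp (E.continuous_repMat N).matrix_det).measurable.pow_const _

/-- The strict inequalities defining positive definiteness form an uncountable family of open
conditions. Replacing them by semidefiniteness, which is closed, together with a nonzero
determinant, which is open, gives a Borel set. -/
theorem measurableSet_posSet (N : ℕ) : MeasurableSet (E.posSet N) := by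
  have heq : E.posSet N = {x | (E.repMat x)ᴴ = E.repMat x} ∩
      (⋂ v : Fin N × m → 𝕜, {x | 0 ≤ star v ⬝ᵥ (E.repMat x *ᵥ v)}) ∩ {x | (E.repMat x).det ≠ 0} := by
    ext x
    simp only [posSet, mem_inter_iff, mem_iInter, mem_ofPred_eq]
    constructor
    · intro h
      exact ⟨⟨h.isHermitian, fun v => h.posSemidef.dotProduct_mulVec_nonneg v⟩,
        h.posSemidef.posDef_iff_det_ne_zero.1 h⟩
    · rintro ⟨⟨h1, h2⟩, h3⟩
      exact (Matrix.PosSemidef.of_dotProduct_mulVec_nonneg h1 h2).posDef_iff_det_ne_zero.2 h3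
  have hc := E.continuous_repMat N
  rw [heq]
  refine (IsClosed.inter (isClosed_eq hc.matrix_conjTranspose hc)
    (isClosed_iInter fun v => ?_)).measurableSet.inter ?_
  · exact isClosed_le continuous_const
      (Continuous.dotProduct continuous_const (hc.matrix_mulVec continuous_const))
  · exact (isOpen_ne_fun hc.matrix_det continuous_const).measurableSet

/-- The integral of a power of the determinant over the positive definite matrices with unit
diagonal. -/
def detIntegral (N : ℕ) (a : ℝ) : ℝ≥0∞ :=
  ∫⁻ x in E.posSet N, ENNReal.ofReal (E.detFn x ^ a)

theorem detIntegral_zero [Nonempty m] (a : ℝ) : E.detIntegral 0 a = 1 := by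
  have h1 (x : UpperPairs 0 → Fin b → ℝ) : E.detFn x = 1 := by
    rw [(E.isFactor_of_isEmpty _).detFn_eq, one_pow]
  have h2 : E.posSet 0 = univ :=
    eq_univ_of_forall fun x => (E.isFactor_of_isEmpty (E.mat x)).posDef
  simp [detIntegral, h1, h2, volume_pi]

theorem detIntegral_succ [Nonempty m] (N : ℕ) {a : ℝ} (ha : -1 < a) :
    E.detIntegral (N + 1) a = E.detIntegral N (a + b / 2) *
      ENNReal.ofReal (Real.pi ^ ((N * b : ℕ) / 2 : ℝ) * Real.Gamma (a + 1) /
        Real.Gamma (a + (N * b : ℕ) / 2 + 1)) := by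
  have hball := lintegral_one_sub_sum_sq_rpow (ι := Fin N) (κ := Fin b) ha
  rw [Fintype.card_fin, Fintype.card_fin] at hball
  have hm (N : ℕ) (a : ℝ) : Measurable fun x : UpperPairs N → Fin b → ℝ =>
      ENNReal.ofReal (E.detFn x ^ a) := ((E.measurable_detFn N).pow_const a).ennreal_ofReal
  have hmb : Measurable fun p => (E.posSet (N + 1)).indicator
      (fun x => ENNReal.ofReal (E.detFn x ^ a)) (borderEquiv b N p) :=
    ((hm _ a).indicator (E.measurableSet_posSet _)).comp (borderEquiv b N).measurable
  rw [detIntegral, detIntegral, ← lintegral_indicator (E.measurableSet_posSet _),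
    ← lintegral_indicator (E.measurableSet_posSet _),
    ← (measurePreserving_borderEquiv b N).lintegral_comp_emb (borderEquiv b N).measurableEmbedding,
    Measure.volume_eq_prod, lintegral_prod _ hmb.aemeasurable,
    ← lintegral_mul_const _ ((hm _ _).indicator (E.measurableSet_posSet _))]
  refine lintegral_congr fun y => ?_
  by_cases hy : y ∈ E.posSet N
  · obtain ⟨L, δ, h⟩ := E.exists_isFactor hy
    have hδ := h.pos
    have hdet : LinearMap.det (E.mulLeft L) ≠ 0 := by
      rw [h.det_mulLeft_eq]; positivity
    have hmy : Measurable fun u => (E.posSet (N + 1)).indicator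
        (fun x => ENNReal.ofReal (E.detFn x ^ a)) (borderEquiv b N (y, u)) :=
      ((hm _ a).indicator (E.measurableSet_posSet _)).comp
        ((borderEquiv b N).measurable.comp measurable_prodMk_left)
    rw [lintegral_eq_abs_det_mul_lintegral_comp volume hdet hmy, h.det_mulLeft_eq,
      indicator_of_mem hy, ← hball, h.detFn_eq, Real.rpow_add (by positivity),
      mul_comm ((δ ^ 2) ^ a), ENNReal.ofReal_mul (by positivity), mul_assoc]
    -- The Jacobian is a power of the smaller determinant δ²; this is the source of the shift from a
    -- to a + b/2.
    have hδb : |δ ^ b| = (δ ^ 2) ^ ((b : ℝ) / 2) := by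
      rw [abs_of_pos (by positivity), ← Real.rpow_natCast δ 2, ← Real.rpow_mul hδ.le,
        ← Real.rpow_natCast δ b]
      congr 1
      push_cast
      ring
    have hmb : Measurable fun w : Fin N → Fin b → ℝ => {w : Fin N → Fin b → ℝ |
        ∑ i, ∑ j, w i j ^ 2 < 1}.indicator
          (fun w => ENNReal.ofReal ((1 - ∑ i, ∑ j, w i j ^ 2) ^ a)) w :=
      Measurable.indicator (by fun_prop) (measurableSet_lt (by fun_prop) measurable_const)
    rw [hδb, ← lintegral_const_mul _ hmb]
    congr 1
    refine lintegral_congr fun w => ?_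
    by_cases hw : ∑ i, ∑ j, w i j ^ 2 < 1
    · have hwS : w ∈ {w : Fin N → Fin b → ℝ | ∑ i, ∑ j, w i j ^ 2 < 1} := hw
      obtain ⟨L', h'⟩ := h.borderEquiv hw
      rw [indicator_of_mem ((h.borderEquiv_mem_posSet_iff w).2 hw), 
        indicator_of_mem hwS, h'.detFn_eq,
        ← ENNReal.ofReal_mul (by positivity), mul_pow, Real.sq_sqrt (by linarith),
        Real.mul_rpow (by positivity) (by linarith)]
    · have hwS : w ∉ {w : Fin N → Fin b → ℝ | ∑ i, ∑ j, w i j ^ 2 < 1} := hw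
      rw [indicator_of_notMem (mt (h.borderEquiv_mem_posSet_iff w).1 hw), indicator_of_notMem hwS,
        mul_zero]
  -- The whole fibre over such a y vanishes, since a positive definite bordered matrix has a
  -- positive definite leading block.
  · rw [indicator_of_notMem hy, zero_mul]
    simp [indicator_of_notMem (mt E.mem_posSet_of_borderEquiv hy)]

end

end EntryModel

/-! ### Identities between Gamma products. -/

theorem prod_Icc_one_eq_prod_range {R : Type*} [CommMonoid R] (f : ℕ → R) (n : ℕ) :
    ∏ k ∈ Finset.Icc 1 n, f k = ∏ i ∈ Finset.range n, f (i + 1) := by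
  induction n with
  | zero => simp
  | succ n ih => rw [Finset.prod_Icc_succ_top (by lia), ih, Finset.prod_range_succ]

theorem prod_range_mul_div_succ (c : ℝ) (K : ℕ → ℝ) (n : ℕ) (hK : ∀ i ≤ n, K i ≠ 0) :
    ∏ i ∈ Finset.range n, c * K (i + 1) / K i = c ^ n * K n / K 0 := by
  induction n with
  | zero => simp [hK 0 le_rfl]
  | succ n ih =>
    have h0 := hK 0 (by lia)
    have hn := hK n (by lia)
    rw [Finset.prod_range_succ, ih fun i hi => hK i (by lia)]
    field_simp
    ring

noncomputable section GammaProducts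

/-- The Gamma factor `Γ (a + b k / 2 + 1)`. -/
def gammaFactor (b : ℕ) (a : ℝ) (k : ℕ) : ℝ := Real.Gamma (a + b * k / 2 + 1)

theorem gammaFactor_pos (b : ℕ) {a : ℝ} (ha : -1 < a) (k : ℕ) : 0 < gammaFactor b a k := by
  have : (0 : ℝ) ≤ b * k / 2 := by positivity
  exact Real.Gamma_pos_of_pos (by linarith)

theorem gammaFactor_add (b : ℕ) (a : ℝ) (k : ℕ) :
    gammaFactor b (a + b / 2) k = gammaFactor b a (k + 1) := by
  simp only [gammaFactor]
  congr 1
  push_cast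
  ring

/-- The closed form of the normalisation for matrices of size `n + 1`. -/
def gammaProd (b n : ℕ) (a : ℝ) : ℝ :=
  ∏ i ∈ Finset.range n,
    (Real.pi ^ ((b : ℝ) / 2) * gammaFactor b a i / gammaFactor b a (i + 1)) ^ (i + 1)

theorem gammaProd_pos (b n : ℕ) {a : ℝ} (ha : -1 < a) : 0 < gammaProd b n a :=
  Finset.prod_pos fun i _ => by
    have := gammaFactor_pos b ha i
    have := gammaFactor_pos b ha (i + 1)
    positivity

/-- Split each exponent i + 1 as i plus 1. The single copies telescope to the last factor. In the
product with exponents i the term i = 0 is trivial, and shifting the index amounts to replacing a by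
a + b/2. -/
theorem gammaProd_succ (b n : ℕ) {a : ℝ} (ha : -1 < a) :
    gammaProd b (n + 1) a = gammaProd b n (a + b / 2) *
      ((Real.pi ^ ((b : ℝ) / 2)) ^ (n + 1) * gammaFactor b a 0 / gammaFactor b a (n + 1)) := by
  have h := prod_range_mul_div_succ (Real.pi ^ ((b : ℝ) / 2)) (fun i => (gammaFactor b a i)⁻¹) (n + 1)
    fun i _ => (inv_pos.2 (gammaFactor_pos b ha i)).ne'
  have h2 (i j : ℕ) (c : ℝ) : c * (gammaFactor b a i)⁻¹ / (gammaFactor b a j)⁻¹ =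
      c * gammaFactor b a j / gammaFactor b a i := by
    rw [div_inv_eq_mul]
    ring
  simp only [h2] at h
  rw [← h, gammaProd]
  simp only [pow_succ, Finset.prod_mul_distrib]
  congr 1
  rw [Finset.prod_range_succ', gammaProd]
  simp [gammaFactor_add, pow_succ]

theorem gammaProd_eq_prod_beta (b n : ℕ) {a : ℝ} (ha : -1 < a) :
    gammaProd b n a = ∏ k ∈ Finset.Icc 1 n, ∏ s ∈ Finset.range b,
      ProbabilityTheory.beta (a + ((b : ℝ) * (k : ℝ) + 1 - (s : ℝ)) / 2) (1 / 2) ^ k := by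
  rw [prod_Icc_one_eq_prod_range, gammaProd]
  refine Finset.prod_congr rfl fun i _ => ?_
  rw [Finset.prod_pow]
  congr 1
  -- With x the first Beta argument, K s is Γ(x + 1/2) and K (s + 1) is Γ(x). Each B(x, 1/2) is thus
  -- √π K (s + 1) / K s, and the product over s telescopes to the endpoints s = 0 and s = b.
  let K : ℕ → ℝ := fun s => Real.Gamma (a + ((b : ℝ) * (i + 1) + 2 - s) / 2)
  have hK (s : ℕ) (hs : s ≤ b) : K s ≠ 0 := by
    have h1 : (s : ℝ) ≤ b := by exact_mod_cast hs
    have h2 : (0 : ℝ) ≤ b * i := by positivity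
    exact (Real.Gamma_pos_of_pos (by linarith)).ne'
  have hbeta (s : ℕ) : ProbabilityTheory.beta
      (a + ((b : ℝ) * ((i + 1 : ℕ) : ℝ) + 1 - (s : ℝ)) / 2) (1 / 2) =
      √Real.pi * K (s + 1) / K s := by
    simp only [ProbabilityTheory.beta, Real.Gamma_one_half_eq, K]
    rw [mul_comm √Real.pi]
    push_cast
    ring_nf
  simp only [hbeta]
  rw [prod_range_mul_div_succ _ K b hK, Real.sqrt_eq_rpow, ← Real.rpow_natCast,
    ← Real.rpow_mul Real.pi_pos.le]
  simp only [K, gammaFactor]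
  push_cast
  ring_nf

theorem gammaProd_eq_prod_div (b n : ℕ) (a : ℝ) :
    gammaProd b n a = ∏ k ∈ Finset.Icc 1 n,
      (Real.pi ^ ((b : ℝ) / 2) * Real.Gamma (a + (b : ℝ) * ((k : ℝ) - 1) / 2 + 1) /
        Real.Gamma (a + (b : ℝ) * (k : ℝ) / 2 + 1)) ^ k := by
  rw [prod_Icc_one_eq_prod_range]
  simp [gammaProd, gammaFactor]

theorem gammaProd_eq_div_mul_prod (b n : ℕ) {a : ℝ} (ha : -1 < a) :
    gammaProd b n a = Real.pi ^ ((b : ℝ) * n * (n + 1 : ℝ) / 4) / gammaFactor b a n ^ n *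
      ∏ i ∈ Finset.range n, gammaFactor b a i := by
  induction n with
  | zero => simp [gammaProd]
  | succ n ih =>
    have hn := (gammaFactor_pos b ha n).ne'
    have hn1 := (gammaFactor_pos b ha (n + 1)).ne'
    have hpi : Real.pi ^ ((b : ℝ) * (n + 1 : ℕ) * ((n + 1 : ℕ) + 1 : ℝ) / 4) =
        Real.pi ^ ((b : ℝ) * n * (n + 1 : ℝ) / 4) * (Real.pi ^ ((b : ℝ) / 2)) ^ (n + 1) := by
      rw [← Real.rpow_natCast, ← Real.rpow_mul Real.pi_pos.le, ← Real.rpow_add Real.pi_pos]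
      congr 1
      push_cast
      ring
    rw [gammaProd, Finset.prod_range_succ, ← gammaProd, ih, hpi, Finset.prod_range_succ, div_pow,
      mul_pow]
    field_simp
    ring

end GammaProducts

/-! ### Closed form and integrability for a general entry model. -/

namespace EntryModel

/-- The exponent is generalized because the recursion calls the smaller size at a + b/2. -/
theorem detIntegral_succ_eq {A : Type*} [Ring A] [StarRing A] [Algebra ℝ A] [StarModule ℝ A]
    {b : ℕ} {m : Type*} [Fintype m] [DecidableEq m] [Nonempty m] {𝕜 : Type*} [RCLike 𝕜]
    (E : EntryModel A b m 𝕜) (n : ℕ) {a : ℝ} (ha : -1 < a) :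
    E.detIntegral (n + 1) a = ENNReal.ofReal (gammaProd b n a) := by
  induction n generalizing a with
  | zero =>
    have h : Real.Gamma (a + 1) ≠ 0 := (Real.Gamma_pos_of_pos (by linarith)).ne'
    rw [E.detIntegral_succ 0 ha, detIntegral_zero]
    simp [gammaProd, h]
  | succ n ih =>
    have hb : -1 < a + b / 2 := by
      have : (0 : ℝ) ≤ b / 2 := by positivity
      linarith
    rw [E.detIntegral_succ _ ha, ih hb, ← ENNReal.ofReal_mul (gammaProd_pos b n hb).le,
      gammaProd_succ b n ha, ← Real.rpow_natCast, ← Real.rpow_mul Real.pi_pos.le]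
    simp only [gammaFactor]
    push_cast
    ring_nf

theorem normalisation_of_eq {A : Type*} [Ring A] [StarRing A] [Algebra ℝ A] [StarModule ℝ A]
    {m : Type*} [Fintype m] [DecidableEq m] [Nonempty m] {𝕜 : Type*} [RCLike 𝕜]
    {F : EntryField} (E : EntryModel A F.beta m 𝕜) (n : ℕ)
    (hS : correlationSet F (n + 1) = E.posSet (n + 1))
    (hD : correlationDet F (n + 1) = E.detFn) {a : ℝ} (ha : -1 < a) :
    IntegrableOn (fun x => correlationDet F (n + 1) x ^ a) (correlationSet F (n + 1)) ∧
      correlationNormalisation F (n + 1) a = gammaProd F.beta n a := by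
  have hm : AEStronglyMeasurable (fun x => E.detFn x ^ a)
      (volume.restrict (E.posSet (n + 1))) :=
    ((E.measurable_detFn (n + 1)).pow_const a).aestronglyMeasurable
  have h0 : 0 ≤ᵐ[volume.restrict (E.posSet (n + 1))] fun x => E.detFn x ^ a := by
    filter_upwards [ae_restrict_mem (E.measurableSet_posSet (n + 1))] with x hx
    exact Real.rpow_nonneg (E.detFn_pos hx).le a
  have hI := E.detIntegral_succ_eq n ha
  rw [detIntegral] at hI
  rw [correlationNormalisation, hS, hD]
  refine ⟨⟨hm, ?_⟩, ?_⟩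
  · rw [hasFiniteIntegral_iff_ofReal h0, hI]
    exact ENNReal.ofReal_lt_top
  · rw [integral_eq_lintegral_of_nonneg_ae h0 hm, hI,
      ENNReal.toReal_ofReal (gammaProd_pos _ n ha).le]

end EntryModel

/-! ### The real, complex and quaternion models. -/

noncomputable section Models

/-- A scalar as a matrix of size one. -/
def scalarRep (𝕜 : Type*) [RCLike 𝕜] : 𝕜 →⋆ₐ[ℝ] Matrix Unit Unit 𝕜 where
  toFun z := Matrix.of fun _ _ => z
  map_one' := by ext; simp
  map_mul' z w := by ext; simp [Matrix.mul_apply]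
  map_zero' := rfl
  map_add' _ _ := rfl
  commutes' r := by ext; simp [Matrix.algebraMap_matrix_apply]
  map_star' z := by ext; simp

/-- The real entries. -/
def realModel : EntryModel ℝ 1 Unit ℝ where
  coord := LinearEquiv.funUnique (Fin 1) ℝ ℝ
  star_mul_self x := by simp [sq]
  rep := scalarRep ℝ

/-- The complex entries. -/
def complexModel : EntryModel ℂ 2 Unit ℂ where
  coord :=
    { toFun x := ⟨x 0, x 1⟩
      invFun z := ![z.re, z.im]
      map_add' _ _ := rfl
      map_smul' _ _ := by apply Complex.ext <;> simp
      left_inv x := by ext i; fin_cases i <;> rfl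
      right_inv _ := rfl }
  star_mul_self x := by
    change star (⟨x 0, x 1⟩ : ℂ) * ⟨x 0, x 1⟩ = ((∑ i, x i ^ 2 : ℝ) : ℂ)
    rw [Fin.sum_univ_two]
    apply Complex.ext
    · simp only [Complex.star_def, Complex.mul_re, Complex.conj_re, Complex.conj_im,
        Complex.ofReal_re]
      ring
    · simp only [Complex.star_def, Complex.mul_im, Complex.conj_re, Complex.conj_im,
        Complex.ofReal_im]
      ring
  rep := scalarRep ℂ

/-- The representation of quaternions by complex matrices of size two. -/
def quaternionBlockRep : ℍ[ℝ] →⋆ₐ[ℝ] Matrix (Fin 2) (Fin 2) ℂ where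
  toFun := quaternionBlock
  map_one' := by
    ext i j; fin_cases i <;> fin_cases j <;> apply Complex.ext <;> simp [quaternionBlock]
  map_mul' p q := by
    ext i j
    fin_cases i <;> fin_cases j <;> apply Complex.ext <;>
      simp [quaternionBlock, Matrix.mul_apply] <;> ring
  map_zero' := by
    ext i j; fin_cases i <;> fin_cases j <;> apply Complex.ext <;> simp [quaternionBlock]
  map_add' p q := by
    ext i j
    fin_cases i <;> fin_cases j <;> apply Complex.ext <;> simp [quaternionBlock] <;> ring
  commutes' r := by
    ext i j
    fin_cases i <;> fin_cases j <;> apply Complex.ext <;>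
      simp [quaternionBlock, Matrix.algebraMap_matrix_apply]
  map_star' q := by
    ext i j; fin_cases i <;> fin_cases j <;> apply Complex.ext <;> simp [quaternionBlock]

instance : StarModule ℝ ℍ[ℝ] := ⟨fun r q => by ext <;> simp⟩

/-- The quaternion entries. -/
def quaternionModel : EntryModel ℍ[ℝ] 4 (Fin 2) ℂ where
  coord :=
    { toFun x := ⟨x 0, x 1, x 2, x 3⟩
      invFun q := ![q.re, q.imI, q.imJ, q.imK]
      map_add' _ _ := rfl
      map_smul' _ _ := by ext <;> rfl
      left_inv x := by ext i; fin_cases i <;> rfl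
      right_inv _ := rfl }
  star_mul_self x := by
    obtain ⟨q, hq⟩ : ∃ q : ℍ[ℝ], q = ⟨x 0, x 1, x 2, x 3⟩ := ⟨_, rfl⟩
    have h : star q * q = ((∑ i, x i ^ 2 : ℝ) : ℍ[ℝ]) := by
      rw [Fin.sum_univ_four, Quaternion.star_mul_self, Quaternion.normSq_def', hq]
    rw [hq] at h
    exact h
  rep := quaternionBlockRep

theorem posDef_blockRep_scalarRep_iff {𝕜 : Type*} [RCLike 𝕜] {N : ℕ}
    (M : Matrix (Fin N) (Fin N) 𝕜) :
    (blockRep (scalarRep 𝕜).toAlgHom (Fin N) M).PosDef ↔ M.PosDef :=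
  ⟨fun h => h.submatrix (Equiv.prodUnique (Fin N) Unit).symm.injective,
    fun h => h.submatrix (Equiv.prodUnique (Fin N) Unit).injective⟩

theorem det_blockRep_scalarRep {𝕜 : Type*} [RCLike 𝕜] {N : ℕ} (M : Matrix (Fin N) (Fin N) 𝕜) :
    (blockRep (scalarRep 𝕜).toAlgHom (Fin N) M).det = M.det :=
  Matrix.det_submatrix_equiv_self (Equiv.prodUnique (Fin N) Unit) M

theorem correlation_normalisation (F : EntryField) (n : ℕ) {a : ℝ} (ha : -1 < a) :
    IntegrableOn (fun x => correlationDet F (n + 1) x ^ a) (correlationSet F (n + 1)) ∧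
      correlationNormalisation F (n + 1) a = gammaProd F.beta n a := by
  cases F with
  | real =>
    refine EntryModel.normalisation_of_eq (F := .real) realModel n ?_ ?_ ha
    · ext x
      exact (posDef_blockRep_scalarRep_iff (realMatrix x)).symm
    · funext x
      have h := det_blockRep_scalarRep (realMatrix x)
      change (realMatrix x).det =
        (blockRep (scalarRep ℝ).toAlgHom _ (realMatrix x)).det ^ ((Fintype.card Unit : ℝ)⁻¹)
      simp [h]
  | complex =>
    refine EntryModel.normalisation_of_eq (F := .complex) complexModel n ?_ ?_ ha
    · ext x
      exact (posDef_blockRep_scalarRep_iff (complexMatrix x)).symm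
    · funext x
      have h := det_blockRep_scalarRep (complexMatrix x)
      change (complexMatrix x).det.re =
        (blockRep (scalarRep ℂ).toAlgHom _ (complexMatrix x)).det.re ^ ((Fintype.card Unit : ℝ)⁻¹)
      simp [h]
  | quaternion =>
    -- The block representation unfolds to `quaternionMatrixRep`, so the two sets agree by `rfl`;
    -- the exponent 1/2 of `detFn` is the square root in `correlationDet`.
    refine EntryModel.normalisation_of_eq (F := .quaternion) quaternionModel n rfl ?_ ha
    funext x
    change √((quaternionMatrixRep (quaternionMatrix x)).det.re) =
      (quaternionMatrixRep (quaternionMatrix x)).det.re ^ ((Fintype.card (Fin 2) : ℝ)⁻¹)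
    simp [Real.sqrt_eq_rpow]

end Models

theorem mainTheorem7 (F : EntryField) (N : ℕ) (hN : 1 ≤ N) :
    (∀ a : ℝ, -1 < a →
      MeasureTheory.IntegrableOn (fun x => correlationDet F N x ^ a) (correlationSet F N) ∧
      0 < correlationNormalisation F N a ∧
      correlationNormalisation F N a =
        ∏ k ∈ Finset.Icc 1 (N - 1), ∏ s ∈ Finset.range F.beta,
          ProbabilityTheory.beta (a + ((F.beta : ℝ) * (k : ℝ) + 1 - (s : ℝ)) / 2) (1 / 2) ^ k ∧
      correlationNormalisation F N a =
        ∏ k ∈ Finset.Icc 1 (N - 1),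
          (Real.pi ^ ((F.beta : ℝ) / 2) *
              Real.Gamma (a + (F.beta : ℝ) * ((k : ℝ) - 1) / 2 + 1) /
            Real.Gamma (a + (F.beta : ℝ) * (k : ℝ) / 2 + 1)) ^ k ∧
      correlationNormalisation F N a =
        Real.pi ^ ((F.beta : ℝ) * ((N : ℝ) - 1) * (N : ℝ) / 4) /
            Real.Gamma (a + (F.beta : ℝ) / 2 * ((N : ℝ) - 1) + 1) ^ (N - 1) *
          ∏ k ∈ Finset.Icc 1 (N - 1),
            Real.Gamma (a + (F.beta : ℝ) / 2 * ((k : ℝ) - 1) + 1)) ∧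
    MeasureTheory.volume (correlationSet F N) =
      ENNReal.ofReal (correlationNormalisation F N 0) := by
  obtain ⟨n, rfl⟩ : ∃ n, N = n + 1 := ⟨N - 1, by lia⟩
  refine ⟨fun a ha => ?_, ?_⟩
  · obtain ⟨hI, hC⟩ := correlation_normalisation F n ha
    rw [hC, Nat.add_sub_cancel]
    refine ⟨hI, gammaProd_pos _ n ha, gammaProd_eq_prod_beta _ n ha, gammaProd_eq_prod_div _ n a, ?_⟩
    rw [gammaProd_eq_div_mul_prod _ n ha, prod_Icc_one_eq_prod_range]
    simp only [gammaFactor]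
    push_cast
    ring_nf
  · obtain ⟨hI, hC⟩ := correlation_normalisation F n (a := 0) (by norm_num)
    simp only [Real.rpow_zero] at hI
    -- At a = 0 the integrand is the constant 1, so integrability means finite volume. This is
    -- needed because the real-valued integral would send an infinite volume to 0.
    have hfin : volume (correlationSet F (n + 1)) ≠ ∞ := by
      simpa [integrableOn_const_iff, lt_top_iff_ne_top] using hI
    simp [correlationNormalisation, Measure.real, ENNReal.ofReal_toReal hfin]
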